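/- **Setting.** Let $f$ be the classifier of a fully connected ReLU network with $n=k+m$ inputs and $K$ logits (any depth and widths): $f(x)$ is a label whose logit is largest, ties being broken by a fixed rule that selects a label from the set of maximizing labels. The first $k$ input coordinates $x_{\mathcal S}$ are the sensitive features, with finite domains $D_1,\dots,D_k\subset\mathbb R$; $x_{\setminus\mathcal S}\in\mathbb R^m$ denotes the others. For $s\in D=D_1\times\dots\times D_k$ let $f_s(z)=f(s,z)$ on $\mathbb R^m$. Let $x^*\in\mathbb R^n$. *Fairness.* $f$ is $\varepsilon$-individually fair at $x^*$ ($\varepsilon\ge 0$) if $f(x)=f(x^*)$ for all $x$ with $x_{\mathcal S}\in D$ and $\|x_{\setminus\mathcal S}-x^*_{\setminus\mathcal S}\|_2\le\varepsilon$. The individual fairness parameter $\varepsilon^*\in[0,\infty]$ is the supremum of all such $\varepsilon$; it is said to exist if there is at least one. The pointwise robustness radius $\rho_s\in[0,\infty]$ is the supremum of all $\varepsilon\ge 0$ with $f_s(z)=f_s(x^*_{\setminus\mathcal S})$ whenever $\|z-x^*_{\setminus\mathcal S}\|_2\le\varepsilon$. *Complex.* For each activation pattern of the hidden neurons and each label $y$,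 the inputs that are consistent with the pattern (weak inequalities) and at which the logit of $y$ is largest form a polytope $\{x: Ax\le b\}$. Its slice at $s$ is the polytope in $\mathbb R^m$ obtained by substituting $x_{\mathcal S}=s$; $\mathbb P_s$ is the set of slices of dimension $m$. A facet of $P=\{Ax\le b\}$ is an $(m-1)$-dimensional set $F=\{x\in P: a^{T}x=\beta\}$ for a row $a^Tx\le \beta$ of the system with $a\neq0$. It is a boundary facet if it is contained in the decision boundary of $f_s$, the union of the frontiers of the sets $\{f_s=y\}$. Put $d_{\mathrm{proj}}(x,F)=|\beta-a^{T}x|/\|a\|_2$ and $d_{\ell_2}(x,F)=\inf_{y\in F}\|x-y\|_2$. *Algorithm.* $\mathrm{GeoCert}(x,\mathbb P_s,d)$ starts at a polytope of $\mathbb P_s$ containing $x$, marks it as seen and pushes its facets into a priority queue ordered by $d(x,\cdot)$. Repeatedly a facet of minimal $d$ is popped; if it is a boundary facet, its distance is returned; otherwise the polytopes of $\mathbb P_s$ having this facet that have not been seen are marked as seen and all their facets are pushed. If the queue becomes empty, $\infty$ is returned. Choices (starting polytope, ties in the queue) are arbitrary. The certification algorithm with distance $d$ returns $\varepsilon_d=\min_{s\in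 D}\mathrm{GeoCert}(x^*_{\setminus\mathcal S},\mathbb P_s,d)$; with $d=d_{\mathrm{proj}}$ its output is $\varepsilon_{LB}$. **Theorem.** 1. With $d=d_{\mathrm{proj}}$ as well as with $d=d_{\ell_2}$ the algorithm has an output, and for all possible outputs $\varepsilon_{d_{\mathrm{proj}}}\le\varepsilon_{d_{\ell_2}}$. 2. Suppose that for every $s\in D$ the decision regions of $f_s$ have no lower-dimensional pieces, i.e. every $z\in\mathbb R^m$ lies in the closure of the interior of $\{w: f_s(w)=f_s(z)\}$. Then every possible output satisfies $\varepsilon_{LB}\le\min_{s\in D}\rho_s$, and, if the individual fairness parameter $\varepsilon^*$ of $f$ at $x^*$ exists, $\varepsilon_{LB}\le\varepsilon^*$. -/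

import Mathlib

open scoped ENNReal NNReal Matrix

noncomputable section

namespace FairCert

/-! ### Local individual fairness -/

/-- `f` is `ε`-individually fair at `xs` for the similarity measure `d`; `D` is the set of
admissible inputs. -/
def IsIndividuallyFair {X Y : Type*} (f : X → Y) (d : X → X → ℝ) (D : Set X) (xs : X)
    (ε : ℝ≥0) : Prop :=
  ∀ x ∈ D, d x xs ≤ ε → f xs = f x

/-- The local individual fairness parameter: the supremum in `[0, ∞]` of all `ε ≥ 0` for which
`f` is `ε`-individually fair at `xs`. -/
def fairnessParameter {X Y : Type*} (f : X → Y) (d : X → X → ℝ) (D : Set X) (xs : X) : ℝ≥0∞ :=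
  ⨆ (ε : ℝ≥0) (_ : IsIndividuallyFair f d D xs ε), (ε : ℝ≥0∞)

/-- The exact pointwise `ℓ₂` robustness radius of a classifier on `ℝᵐ`. -/
def robustnessRadius {m : ℕ} {Y : Type*} (g : EuclideanSpace ℝ (Fin m) → Y)
    (z : EuclideanSpace ℝ (Fin m)) : ℝ≥0∞ :=
  fairnessParameter g dist Set.univ z

/-! ### Inputs with `k` sensitive and `m` non-sensitive features

An input is a vector in `ℝ^(k+m)`; its first `k` coordinates are the sensitive features. -/

/-- The non-sensitive part of an input, with the Euclidean norm. -/
def nonSensitive {k m : ℕ} (x : Fin (k + m) → ℝ) : EuclideanSpace ℝ (Fin m) :=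
  WithLp.toLp 2 fun j => x (Fin.natAdd k j)

/-- The weighted `ℓ₂` distance with weight `1` on the non-sensitive and weight `0` on the
sensitive features. -/
def fairDist {k m : ℕ} (x x' : Fin (k + m) → ℝ) : ℝ :=
  dist (nonSensitive x) (nonSensitive x')

/-- The inputs whose sensitive features take values in their (finite) domains. -/
def admissible {k : ℕ} (m : ℕ) (dom : Fin k → Finset ℝ) : Set (Fin (k + m) → ℝ) :=
  {x | ∀ i, x (Fin.castAdd m i) ∈ dom i}

/-! ### Fully connected ReLU networks -/

/-- Fully connected ReLU networks with `n` inputs and `K` outputs (logits), of any depth and any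
widths: hidden layers `v ↦ ReLU (W v + b)` followed by an affine output layer. -/
inductive ReLUNet : ℕ → ℕ → Type
  | output {n K : ℕ} (W : Matrix (Fin K) (Fin n) ℝ) (b : Fin K → ℝ) : ReLUNet n K
  | hidden {n h K : ℕ} (W : Matrix (Fin h) (Fin n) ℝ) (b : Fin h → ℝ) (rest : ReLUNet h K) :
      ReLUNet n K

namespace ReLUNet

/-- The pre-softmax outputs of the network. -/
def logits : {n K : ℕ} → ReLUNet n K → (Fin n → ℝ) → (Fin K → ℝ)
  | _, _, .output W b, x => W *ᵥ x + b
  | _, _, .hidden W b rest, x => rest.logits fun i => max ((W *ᵥ x + b) i) 0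

open Classical in
/-- The classifier of the network: a label with the largest logit. The fixed rule `tie` selects
one label from the set of all maximizing labels. -/
def classify {n K : ℕ} (N : ReLUNet n K) (tie : Finset (Fin K) → Fin K) (x : Fin n → ℝ) : Fin K :=
  tie (Finset.univ.filter fun i => ∀ j, N.logits x j ≤ N.logits x i)

/-- The classifier on the slice where the sensitive features have the value `s`. -/
def slice {k m K : ℕ} (N : ReLUNet (k + m) K) (tie : Finset (Fin K) → Fin K) (s : Fin k → ℝ)
    (z : EuclideanSpace ℝ (Fin m)) : Fin K :=
  N.classify tie (Fin.append s fun j => z j)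

/-- Activation patterns: one bit (active / inactive) for every hidden neuron. -/
def Pattern : {n K : ℕ} → ReLUNet n K → Type
  | _, _, .output _ _ => Unit
  | _, _, .hidden (h := h) _ _ rest => (Fin h → Bool) × rest.Pattern

end ReLUNet

/-! ### Polytopes given by linear inequalities, and their facets -/

/-- One row of a system `A x ≤ b`. -/
structure HalfSpace (n : ℕ) where
  normal : Fin n → ℝ
  bound : ℝ

/-- A polytope presented as a finite system `A x ≤ b`. -/
abbrev HPolytope (n : ℕ) := List (HalfSpace n)

/-- The set `{x | A x ≤ b}`. -/
def HPolytope.carrier {n : ℕ} (P : HPolytope n) : Set (EuclideanSpace ℝ (Fin n)) :=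
  {x | ∀ h ∈ P, h.normal ⬝ᵥ (fun j => x j) ≤ h.bound}

/-- A facet, stored with the equation `aᵀ x = b` of a hyperplane containing it. -/
structure Facet (n : ℕ) where
  row : HalfSpace n
  carrier : Set (EuclideanSpace ℝ (Fin n))

/-- The facets of `P = {x | A x ≤ b}`: the `(n-1)`-dimensional sets
`{x ∈ P | Aᵢ x = bᵢ}` with `Aᵢ ≠ 0`. -/
def HPolytope.facets {n : ℕ} (P : HPolytope n) : Set (Facet n) :=
  {F | F.row ∈ P ∧ F.row.normal ≠ 0 ∧
    F.carrier = {x | x ∈ HPolytope.carrier P ∧ F.row.normal ⬝ᵥ (fun j => x j) = F.row.bound} ∧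
    F.carrier.Nonempty ∧ Module.finrank ℝ (vectorSpan ℝ F.carrier) + 1 = n}

/-- The exact `ℓ₂` distance from a point to a facet. -/
def distL2 {n : ℕ} (x : EuclideanSpace ℝ (Fin n)) (F : Facet n) : ℝ :=
  Metric.infDist x F.carrier

/-- The projection distance: the distance `|b - aᵀ x| / ‖a‖₂` from a point to the hyperplane
`aᵀ x = b` containing the facet. -/
def distProj {n : ℕ} (x : EuclideanSpace ℝ (Fin n)) (F : Facet n) : ℝ :=
  |F.row.bound - F.row.normal ⬝ᵥ (fun j => x j)| / ‖WithLp.toLp 2 F.row.normal‖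

/-! ### The polyhedral complex of a network -/

/-- The linear inequalities in the input `x ∈ ℝⁿ` saying that the (sub)network `N`, fed with
`M x + c`, has the activation pattern `σ` and that the label `y` has a largest logit. On the
pattern `σ` every layer is affine in `x`; an active neuron contributes `A_i x + a_i ≥ 0` and an
inactive one `A_i x + a_i ≤ 0`. -/
def ReLUNet.rows {n : ℕ} : {p K : ℕ} → (N : ReLUNet p K) → Matrix (Fin p) (Fin n) ℝ →
    (Fin p → ℝ) → N.Pattern → Fin K → HPolytope n
  | _, _, .output W b, M, c, _, y =>
      List.ofFn fun j =>
        ⟨(W * M) j - (W * M) y, (W *ᵥ c + b) y - (W *ᵥ c + b) j⟩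
  | _, _, .hidden W b rest, M, c, σ, y =>
      (List.ofFn fun i =>
        if σ.1 i then ⟨-(W * M) i, (W *ᵥ c + b) i⟩ else ⟨(W * M) i, -(W *ᵥ c + b) i⟩) ++
      rest.rows (Matrix.of fun i j => if σ.1 i then (W * M) i j else 0)
        (fun i => if σ.1 i then (W *ᵥ c + b) i else 0) σ.2 y

/-- The polytopes of the network: one for every activation pattern and every label, so that every
decision region is a union of polytopes. Some of these systems are infeasible or have
lower-dimensional solution sets; these are discarded after slicing. -/
def ReLUNet.polytopes {n K : ℕ} (N : ReLUNet n K) : Set (HPolytope n) :=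
  {P | ∃ (σ : N.Pattern) (y : Fin K), P = N.rows 1 0 σ y}

/-- Substituting `s` for the first `k` coordinates in the inequalities of a polytope. -/
def HPolytope.reduce {k m : ℕ} (P : HPolytope (k + m)) (s : Fin k → ℝ) : HPolytope m :=
  P.map fun h =>
    ⟨fun j => h.normal (Fin.natAdd k j), h.bound - ∑ i, h.normal (Fin.castAdd m i) * s i⟩

/-- `ReducePolyDim`: the polytopes of dimension `m = n - k` obtained by fixing the `k` sensitive
features to `s` in all polytopes of dimension `n = k + m`. -/
def reducePolyDim {k m : ℕ} (ℙ : Set (HPolytope (k + m))) (s : Fin k → ℝ) : Set (HPolytope m) :=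
  {P' | (∃ P ∈ ℙ, P' = HPolytope.reduce P s) ∧ (interior (HPolytope.carrier P')).Nonempty}

/-! ### Decision boundary -/

/-- The decision boundary: the points on the frontier of some decision region. -/
def decisionBoundary {m : ℕ} {Y : Type*} (g : EuclideanSpace ℝ (Fin m) → Y) :
    Set (EuclideanSpace ℝ (Fin m)) :=
  {z | ∃ y, z ∈ frontier {w | g w = y}}

/-- A boundary facet lies on the decision boundary. -/
def IsBoundary {m : ℕ} {Y : Type*} (g : EuclideanSpace ℝ (Fin m) → Y) (F : Facet m) : Prop :=
  F.carrier ⊆ decisionBoundary g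

/-- No decision region has lower-dimensional pieces: every point is a limit of points around which
the classifier is constant with the same label. -/
def FullDimRegions {m : ℕ} {Y : Type*} (g : EuclideanSpace ℝ (Fin m) → Y) : Prop :=
  ∀ z, z ∈ closure (interior {w | g w = g z})

/-! ### GeoCert and the certification algorithm -/

/-- The polytopes of the complex that have the facet `F`. -/
def neighbors {m : ℕ} (ℙ : Set (HPolytope m)) (F : Facet m) : Set (HPolytope m) :=
  {P | P ∈ ℙ ∧ ∃ G ∈ HPolytope.facets P, G.carrier = F.carrier}

/-- The main loop of GeoCert. `Loop ℙ g dst x Q C ε` says that from priority queue `Q` and set `C`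
of seen polytopes the loop can return `ε`. A facet at minimal distance is popped (ties in an
arbitrary way); if it is a boundary facet, its distance is returned; otherwise all facets of the
unseen polytopes sharing it are pushed, and these polytopes are marked as seen. If the queue runs
empty, no boundary facet was found and the value is `∞`. -/
inductive GeoCert.Loop {m : ℕ} {Y : Type*} (ℙ : Set (HPolytope m))
    (g : EuclideanSpace ℝ (Fin m) → Y) (dst : EuclideanSpace ℝ (Fin m) → Facet m → ℝ)
    (x : EuclideanSpace ℝ (Fin m)) : Set (Facet m) → Set (HPolytope m) → ℝ≥0∞ → Prop
  | empty (C : Set (HPolytope m)) : Loop ℙ g dst x ∅ C ⊤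
  | boundary (Q : Set (Facet m)) (C : Set (HPolytope m)) (F : Facet m) (hF : F ∈ Q)
      (hmin : ∀ G ∈ Q, dst x F ≤ dst x G) (hb : IsBoundary g F) :
      Loop ℙ g dst x Q C (ENNReal.ofReal (dst x F))
  | step (Q : Set (Facet m)) (C : Set (HPolytope m)) (F : Facet m) (hF : F ∈ Q)
      (hmin : ∀ G ∈ Q, dst x F ≤ dst x G) (hb : ¬ IsBoundary g F) (ε : ℝ≥0∞)
      (hnext : Loop ℙ g dst x
        ((Q \ {F}) ∪ {G | ∃ P ∈ neighbors ℙ F \ C, G ∈ HPolytope.facets P})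
        (C ∪ neighbors ℙ F) ε) :
      Loop ℙ g dst x Q C ε

/-- `GeoCert ℙ g dst x ε`: GeoCert, started from a polytope of the complex `ℙ` containing `x` and
run with the facet distance `dst`, can return `ε`. -/
def GeoCert {m : ℕ} {Y : Type*} (ℙ : Set (HPolytope m)) (g : EuclideanSpace ℝ (Fin m) → Y)
    (dst : EuclideanSpace ℝ (Fin m) → Facet m → ℝ) (x : EuclideanSpace ℝ (Fin m))
    (ε : ℝ≥0∞) : Prop :=
  ∃ P ∈ ℙ, x ∈ HPolytope.carrier P ∧ GeoCert.Loop ℙ g dst x (HPolytope.facets P) {P} ε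

/-- The certification algorithm: run GeoCert on the slice of the polyhedral complex for every
combination `s` of sensitive values and return the minimum of the results `εs s`.
`Certifies N tie dom dst xs ε` says that `ε` is a possible output. -/
def Certifies {k m K : ℕ} (N : ReLUNet (k + m) K) (tie : Finset (Fin K) → Fin K)
    (dom : Fin k → Finset ℝ) (dst : EuclideanSpace ℝ (Fin m) → Facet m → ℝ)
    (xs : Fin (k + m) → ℝ) (ε : ℝ≥0∞) : Prop :=
  ∃ εs : (Fin k → ℝ) → ℝ≥0∞,
    (∀ s ∈ Fintype.piFinset dom,
      GeoCert (reducePolyDim N.polytopes s) (N.slice tie s) dst (nonSensitive xs) (εs s)) ∧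
    ε = (Fintype.piFinset dom).inf εs

end FairCert

end

namespace FairCert

/-! ### Activation patterns and the polytopes of a network -/

namespace HPolytope

/-! Geometry of one slice. The full-dimensional slices at `s` form a finite polyhedral complex: they
cover ℝᵐ and meet face to face (`isComplex_reducePolyDim`). The face-to-face property holds because,
on one activation pattern, every layer is affine: if a proper convex combination of two inputs of
one polytope satisfies the sign and maximality conditions of another, so do the two inputs
(`Consistent.left_of_comb`).

Search. When GeoCert stops with output ε, every facet of a seen polytope at distance less than ε is
not a boundary facet, and all its neighbors have been seen (`GeoCert.exists_seen`). A facet meeting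
the closed ball of radius r around the start has projection distance at most r. For r < ε, the seen
family is therefore closed under crossing facets that meet the ball. Since the ball is connected,
such a family contains, up to equality of carriers, every polytope meeting the ball
(`IsComplex.mem_of_meets`). This reduces to the polytopes around one point, where a generic segment
avoids all intersections of codimension at least two and so changes polytope only through facets.
Hence no boundary facet meets the ball (`IsComplex.not_isBoundary`).

Both claims follow. A finite output for the exact distance is the distance of a boundary facet,
which would meet a ball of that radius. For robustness, a label can change across a facet only if
the facet is a boundary facet, so all polytopes meeting the ball carry the label of its center.
Full-dimensionality of the regions transfers this from interiors to all points
(`IsComplex.eq_of_mem_closedBall`). -/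

theorem mem_carrier_append {n : ℕ} {P Q : HPolytope n} {x : EuclideanSpace ℝ (Fin n)} :
    x ∈ HPolytope.carrier (P ++ Q) ↔ x ∈ HPolytope.carrier P ∧ x ∈ HPolytope.carrier Q := by
  simp only [HPolytope.carrier, Set.mem_ofPred_eq, List.mem_append, or_imp, forall_and]

theorem mem_carrier_ofFn {n h : ℕ} {f : Fin h → HalfSpace n} {x : EuclideanSpace ℝ (Fin n)} :
    x ∈ HPolytope.carrier (List.ofFn f) ↔
      ∀ i, (f i).normal ⬝ᵥ (fun j => x j) ≤ (f i).bound := by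
  simp only [HPolytope.carrier, Set.mem_ofPred_eq, List.mem_ofFn, forall_exists_index,
    forall_apply_eq_imp_iff]

end HPolytope

namespace ReLUNet

/-- The input `v` is weakly consistent with the activation pattern `σ`, and the label `y` has a
largest logit at `v`. -/
def Consistent : {p K : ℕ} → (N : ReLUNet p K) → N.Pattern → Fin K → (Fin p → ℝ) → Prop
  | _, _, .output W b, _, y, v => ∀ j, (W *ᵥ v + b) j ≤ (W *ᵥ v + b) y
  | _, _, .hidden W b rest, σ, y, v =>
      (∀ i, if σ.1 i then 0 ≤ (W *ᵥ v + b) i else (W *ᵥ v + b) i ≤ 0) ∧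
      rest.Consistent σ.2 y fun i => max ((W *ᵥ v + b) i) 0

theorem Consistent.logits_le : {p K : ℕ} → {N : ReLUNet p K} → {σ : N.Pattern} → {y : Fin K} →
    {v : Fin p → ℝ} → N.Consistent σ y v → ∀ j, N.logits v j ≤ N.logits v y
  | _, _, .output _ _, _, _, _, h => h
  | _, _, .hidden _ _ rest, _, _, _, h => Consistent.logits_le (N := rest) h.2

theorem Consistent.of_logits_le : {p K : ℕ} → {N : ReLUNet p K} → {σ : N.Pattern} → {y y' : Fin K} →
    {v : Fin p → ℝ} → N.Consistent σ y v → (∀ j, N.logits v j ≤ N.logits v y') →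
    N.Consistent σ y' v
  | _, _, .output _ _, _, _, _, _, _, h => h
  | _, _, .hidden _ _ rest, _, _, _, _, h, h' => ⟨h.1, Consistent.of_logits_le (N := rest) h.2 h'⟩

theorem exists_consistent : {p K : ℕ} → (N : ReLUNet p K) → (v : Fin p → ℝ) → (y : Fin K) →
    (∀ j, N.logits v j ≤ N.logits v y) → ∃ σ, N.Consistent σ y v
  | _, _, .output _ _, _, _, h => ⟨(), h⟩
  | _, _, .hidden W b rest, v, y, h => by
      obtain ⟨τ, hτ⟩ := exists_consistent rest (fun i => max ((W *ᵥ v + b) i) 0) y h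
      refine ⟨(fun i => decide (0 ≤ (W *ᵥ v + b) i), τ), fun i => ?_, hτ⟩
      by_cases hi : 0 ≤ (W *ᵥ v + b) i
      · simp only [hi, decide_true, if_true]
      · simp only [hi, decide_false, Bool.false_eq_true, if_false]
        exact (not_le.1 hi).le

theorem affine_comb {p h : ℕ} (W : Matrix (Fin h) (Fin p) ℝ) (b : Fin h → ℝ) (u v : Fin p → ℝ)
    {s t : ℝ} (hst : s + t = 1) :
    W *ᵥ (s • u + t • v) + b = s • (W *ᵥ u + b) + t • (W *ᵥ v + b) := by
  rw [Matrix.mulVec_add, Matrix.mulVec_smul, Matrix.mulVec_smul]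
  nth_rewrite 1 [← one_smul ℝ b, ← hst]
  module

/-- On the inputs consistent with one pattern, the rectifier is affine. -/
theorem relu_comb {a : Bool} {x y s t : ℝ} (hs : 0 < s) (ht : 0 < t)
    (hx : if a then 0 ≤ x else x ≤ 0) (hy : if a then 0 ≤ y else y ≤ 0) :
    max (s * x + t * y) 0 = s * max x 0 + t * max y 0 := by
  cases a
  · simp only [Bool.false_eq_true, if_false] at hx hy
    rw [max_eq_right hx, max_eq_right hy, max_eq_right (by nlinarith)]; simp
  · simp only [if_true] at hx hy
    rw [max_eq_left hx, max_eq_left hy, max_eq_left (by positivity)]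

/-- The inputs consistent with two patterns and labels form a face of the inputs consistent with
one of them. -/
theorem Consistent.left_of_comb : {p K : ℕ} → {N : ReLUNet p K} → {σ σ' : N.Pattern} →
    {y y' : Fin K} → {u v : Fin p → ℝ} → {s t : ℝ} → 0 < s → 0 < t → s + t = 1 →
    N.Consistent σ y u → N.Consistent σ y v → N.Consistent σ' y' (s • u + t • v) →
    N.Consistent σ' y' u
  | _, _, .output W b, _, _, y, y', u, v, s, t, hs, ht, hst, hu, hv, hw => by
      intro j
      -- At the combination `y'` does at least as well as `y`, while at both ends it does at most as
      -- well; hence the two labels tie at `u`.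
      have h1 := hw y
      have h2 := hv y'
      have h3 := hu j
      rw [affine_comb W b u v hst] at h1
      simp only [Pi.add_apply (s • _), Pi.smul_apply, smul_eq_mul] at h1
      nlinarith [hu y', mul_le_mul_of_nonneg_left h2 ht.le]
  | _, _, .hidden W b rest, σ, σ', y, y', u, v, s, t, hs, ht, hst, hu, hv, hw => by
      obtain ⟨hw1, hw2⟩ := hw
      have key : (fun i => max ((W *ᵥ (s • u + t • v) + b) i) 0) =
          s • (fun i => max ((W *ᵥ u + b) i) 0) + t • (fun i => max ((W *ᵥ v + b) i) 0) := by
        rw [affine_comb W b u v hst]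
        funext i
        exact relu_comb hs ht (hu.1 i) (hv.1 i)
      rw [key] at hw2
      refine ⟨fun i => ?_, Consistent.left_of_comb (N := rest) hs ht hst hu.2 hv.2 hw2⟩
      have h1 := hw1 i
      have h2 := hu.1 i
      have h3 := hv.1 i
      rw [affine_comb W b u v hst] at h1
      simp only [Pi.add_apply (s • _), Pi.smul_apply, smul_eq_mul] at h1
      generalize (W *ᵥ u + b) i = x at *
      generalize (W *ᵥ v + b) i = z at *
      -- Where the two bits differ, the pre-activation has one weak sign at `u` and `v` and the
      -- opposite one at their combination, so it vanishes at `u`.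
      cases h : σ.1 i <;> cases h' : σ'.1 i <;>
        simp only [h, h', Bool.false_eq_true, if_false, if_true] at h1 h2 h3 ⊢
      · exact h2
      · nlinarith [mul_nonneg ht.le (neg_nonneg.2 h3)]
      · nlinarith [mul_nonneg ht.le h3]
      · exact h2

/-- Induction on the layers: zeroing the rows of the inactive neurons gives an affine map that
agrees with the rectified layer wherever the sign conditions of that layer hold. The second half of
the equivalence is therefore proved under the first. -/
theorem mem_carrier_rows {n : ℕ} : {p K : ℕ} → (N : ReLUNet p K) → (M : Matrix (Fin p) (Fin n) ℝ) →
    (c : Fin p → ℝ) → (σ : N.Pattern) → (y : Fin K) → (x : EuclideanSpace ℝ (Fin n)) →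
    (x ∈ HPolytope.carrier (N.rows M c σ y) ↔ N.Consistent σ y (M *ᵥ (fun j => x j) + c))
  | _, _, .output W b, M, c, _, y, x => by
      rw [rows, HPolytope.mem_carrier_ofFn]
      refine forall_congr' fun j => ?_
      simp only [sub_dotProduct, Matrix.mulVec_add, Matrix.mulVec_mulVec, Pi.add_apply]
      change (W * M).mulVec _ j - (W * M).mulVec _ y ≤ _ ↔ _
      constructor <;> intro h <;> linarith
  | _, _, .hidden W b rest, M, c, σ, y, x => by
      rw [rows, HPolytope.mem_carrier_append, HPolytope.mem_carrier_ofFn, mem_carrier_rows rest]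
      have hpre : ∀ i, (W *ᵥ (M *ᵥ (fun j => x j) + c) + b) i =
          (W * M) i ⬝ᵥ (fun j => x j) + (W *ᵥ c + b) i := by
        intro i
        simp only [Matrix.mulVec_add, Matrix.mulVec_mulVec, Pi.add_apply, add_assoc]
        rfl
      generalize hz : (fun j => x j) = z at *
      have hfst : (∀ i, (if σ.1 i then (⟨-(W * M) i, (W *ᵥ c + b) i⟩ : HalfSpace n)
          else ⟨(W * M) i, -(W *ᵥ c + b) i⟩).normal ⬝ᵥ z ≤
          (if σ.1 i then (⟨-(W * M) i, (W *ᵥ c + b) i⟩ : HalfSpace n)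
          else ⟨(W * M) i, -(W *ᵥ c + b) i⟩).bound) ↔
          ∀ i, if σ.1 i then 0 ≤ (W *ᵥ (M *ᵥ z + c) + b) i
            else (W *ᵥ (M *ᵥ z + c) + b) i ≤ 0 := by
        refine forall_congr' fun i => ?_
        rw [hpre i]
        cases σ.1 i <;> simp only [Bool.false_eq_true, if_false, if_true, neg_dotProduct] <;>
          constructor <;> intro h <;> linarith
      rw [hfst]
      refine and_congr_right fun h => ?_
      have hsnd : (Matrix.of fun i j => if σ.1 i then (W * M) i j else 0) *ᵥ z +
          (fun i => if σ.1 i then (W *ᵥ c + b) i else 0) =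
          fun i => max ((W *ᵥ (M *ᵥ z + c) + b) i) 0 := by
        funext i
        have hi := h i
        rw [hpre i] at hi ⊢
        simp only [Pi.add_apply, Matrix.mulVec, dotProduct, Matrix.of_apply] at hi ⊢
        cases hσ : σ.1 i <;> simp only [hσ, Bool.false_eq_true, if_false, if_true] at hi ⊢
        · rw [max_eq_right hi]; simp
        · rw [max_eq_left hi]
      rw [hsnd]

/-! ### Slices of the polytopes at fixed sensitive values -/

theorem mem_carrier_reduce {k m : ℕ} (P : HPolytope (k + m)) (s : Fin k → ℝ)
    (z : EuclideanSpace ℝ (Fin m)) :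
    z ∈ HPolytope.carrier (HPolytope.reduce P s) ↔
      WithLp.toLp 2 (Fin.append s fun j => z j) ∈ HPolytope.carrier P := by
  simp only [HPolytope.carrier, HPolytope.reduce, Set.mem_ofPred_eq, List.mem_map,
    forall_exists_index, and_imp, forall_apply_eq_imp_iff₂, dotProduct, Fin.sum_univ_add,
    Fin.append_left, Fin.append_right]
  refine forall₂_congr fun h _ => ?_
  constructor <;> intro h <;> linarith

/-- The slice at `s` of a polytope of the network. -/
def slicedPolytope {k m K : ℕ} (N : ReLUNet (k + m) K) (s : Fin k → ℝ) (σ : N.Pattern)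
    (y : Fin K) : HPolytope m :=
  HPolytope.reduce (N.rows 1 0 σ y) s

theorem mem_slicedPolytope {k m K : ℕ} {N : ReLUNet (k + m) K} {s : Fin k → ℝ} {σ : N.Pattern}
    {y : Fin K} {z : EuclideanSpace ℝ (Fin m)} :
    z ∈ HPolytope.carrier (N.slicedPolytope s σ y) ↔
      N.Consistent σ y (Fin.append s fun j => z j) := by
  rw [slicedPolytope, mem_carrier_reduce, mem_carrier_rows, Matrix.one_mulVec, add_zero]

/-- Convex combinations in ℝᵐ lift to convex combinations of inputs, since the fixed part `s` is
reproduced when the weights sum to one. -/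
theorem isExtreme_slicedPolytope {k m K : ℕ} (N : ReLUNet (k + m) K) (s : Fin k → ℝ)
    (σ σ' : N.Pattern) (y y' : Fin K) :
    IsExtreme ℝ (HPolytope.carrier (N.slicedPolytope s σ y))
      (HPolytope.carrier (N.slicedPolytope s σ y) ∩
        HPolytope.carrier (N.slicedPolytope s σ' y')) := by
  refine ⟨Set.inter_subset_left, ?_⟩
  rintro u hu v hv w ⟨-, hw⟩ ⟨a, b, ha, hb, hab, rfl⟩
  refine ⟨hu, ?_⟩
  rw [mem_slicedPolytope] at hu hv hw ⊢
  refine Consistent.left_of_comb ha hb hab hu hv ?_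
  convert hw using 1
  funext i
  refine Fin.addCases (fun i => ?_) (fun i => ?_) i
  · simp only [Pi.add_apply, Pi.smul_apply, Fin.append_left, smul_eq_mul, ← add_mul, hab, one_mul]
  · simp only [Pi.add_apply, Pi.smul_apply, Fin.append_right, smul_eq_mul, PiLp.add_apply,
      PiLp.smul_apply]

theorem finite_pattern : {p K : ℕ} → (N : ReLUNet p K) → Finite N.Pattern
  | _, _, .output _ _ => inferInstanceAs (Finite Unit)
  | _, _, .hidden (h := h) _ _ rest =>
      have := finite_pattern rest
      inferInstanceAs (Finite ((Fin h → Bool) × rest.Pattern))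

theorem finite_polytopes {n K : ℕ} (N : ReLUNet n K) : N.polytopes.Finite := by
  have := N.finite_pattern
  refine (Set.finite_range fun q : N.Pattern × Fin K => N.rows 1 0 q.1 q.2).subset ?_
  rintro P ⟨σ, y, rfl⟩
  exact ⟨(σ, y), rfl⟩

theorem exists_mem_slicedPolytope {k m K : ℕ} (N : ReLUNet (k + m) K) (hK : 0 < K)
    (s : Fin k → ℝ) (z : EuclideanSpace ℝ (Fin m)) :
    ∃ σ y, z ∈ HPolytope.carrier (N.slicedPolytope s σ y) := by
  have : Nonempty (Fin K) := ⟨⟨0, hK⟩⟩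
  obtain ⟨y, hy⟩ := Finite.exists_max (N.logits (Fin.append s fun j => z j))
  obtain ⟨σ, hσ⟩ := N.exists_consistent _ y hy
  exact ⟨σ, y, mem_slicedPolytope.2 hσ⟩

/-- The face relation between a polytope and an interior point of it forces every other polytope
that contains the interior point to contain the whole polytope. -/
theorem _root_.IsExtreme.subset_of_mem_interior {E : Type*} [AddCommGroup E] [Module ℝ E]
    [TopologicalSpace E] [ContinuousAdd E] [ContinuousSMul ℝ E] {A B : Set E} (h : IsExtreme ℝ A B)
    {x : E} (hx : x ∈ interior A) (hxB : x ∈ B) : A ⊆ B := by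
  intro a ha
  -- Prolong the segment from `a` to `x` slightly beyond `x`; the new end stays in `A`, and `x` is
  -- then strictly between it and `a`.
  have hc : ContinuousAt (fun t : ℝ => x + t • (x + (-1 : ℝ) • a)) 0 := by fun_prop
  have h0 : A ∈ nhds (x + (0 : ℝ) • (x + (-1 : ℝ) • a)) := by
    simpa using mem_interior_iff_mem_nhds.1 hx
  obtain ⟨δ, hδ, hball⟩ := Metric.mem_nhds_iff.1 (hc h0)
  have hmem : x + (δ / 2) • (x + (-1 : ℝ) • a) ∈ A :=
    hball (by simp [abs_of_pos hδ, hδ] : δ / 2 ∈ Metric.ball (0 : ℝ) δ)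
  refine h.left_mem_of_mem_openSegment ha hmem hxB
    ⟨(δ / 2) / (1 + δ / 2), 1 / (1 + δ / 2), by positivity, by positivity, by field_simp; ring, ?_⟩
  have h1 : (1 + δ / 2) ≠ 0 := by positivity
  match_scalars <;> field_simp
  ring

/-- The classifier is constant on the interior of every full-dimensional polytope. -/
theorem slice_eq_of_mem_interior {k m K : ℕ} (N : ReLUNet (k + m) K)
    (tie : Finset (Fin K) → Fin K) (s : Fin k → ℝ) {σ : N.Pattern} {y : Fin K}
    {u v : EuclideanSpace ℝ (Fin m)}
    (hu : u ∈ interior (HPolytope.carrier (N.slicedPolytope s σ y)))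
    (hv : v ∈ interior (HPolytope.carrier (N.slicedPolytope s σ y))) :
    N.slice tie s u = N.slice tie s v := by
  have key : ∀ {u v : EuclideanSpace ℝ (Fin m)},
      u ∈ interior (HPolytope.carrier (N.slicedPolytope s σ y)) →
      v ∈ interior (HPolytope.carrier (N.slicedPolytope s σ y)) → ∀ i,
      (∀ j, N.logits (Fin.append s fun j => u j) j ≤ N.logits (Fin.append s fun j => u j) i) →
      ∀ j, N.logits (Fin.append s fun j => v j) j ≤ N.logits (Fin.append s fun j => v j) i := by
    intro u v hu hv i hi
    -- The slice with the same pattern and label `i` also contains `u`, hence contains the whole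
    -- slice of `y`. So the entire set of maximizing labels is constant, which is what the tie rule
    -- needs.
    have h1 := mem_slicedPolytope.1 (interior_subset hu)
    have h2 := (N.isExtreme_slicedPolytope s σ σ y i).subset_of_mem_interior hu
      ⟨interior_subset hu, mem_slicedPolytope.2 (h1.of_logits_le hi)⟩ (interior_subset hv)
    exact (mem_slicedPolytope.1 h2.2).logits_le
  unfold slice classify
  congr 1
  ext i
  simp only [Finset.mem_filter, Finset.mem_univ, true_and]
  exact ⟨key hu hv i, key hv hu i⟩

end ReLUNet

/-! ### Faces of polyhedra -/

namespace HPolytope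

/-- The linear form of a half-space. -/
def _root_.FairCert.HalfSpace.form {n : ℕ} (h : HalfSpace n) : EuclideanSpace ℝ (Fin n) →ₗ[ℝ] ℝ where
  toFun x := h.normal ⬝ᵥ fun j => x j
  map_add' x y := by
    simp only [PiLp.add_apply]
    exact dotProduct_add _ _ _
  map_smul' c x := by
    simp only [PiLp.smul_apply, RingHom.id_apply]
    exact dotProduct_smul c _ _

theorem _root_.FairCert.HalfSpace.form_apply {n : ℕ} (h : HalfSpace n)
    (x : EuclideanSpace ℝ (Fin n)) : h.form x = h.normal ⬝ᵥ fun j => x j := rfl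

theorem _root_.FairCert.HalfSpace.form_ne_zero {n : ℕ} {h : HalfSpace n} (hn : h.normal ≠ 0) :
    h.form ≠ 0 := by
  intro h0
  apply hn
  have : h.form (WithLp.toLp 2 h.normal) = 0 := by rw [h0]; rfl
  rw [HalfSpace.form_apply] at this
  exact dotProduct_self_eq_zero.1 this

theorem convex_carrier {n : ℕ} (P : HPolytope n) : Convex ℝ P.carrier := by
  intro x hx y hy a b ha hb hab h hh
  have h1 := hx h hh
  have h2 := hy h hh
  rw [← HalfSpace.form_apply] at *
  rw [map_add, map_smul, map_smul, smul_eq_mul, smul_eq_mul]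
  have h3 : (a + b) * h.bound = h.bound := by rw [hab, one_mul]
  nlinarith [mul_le_mul_of_nonneg_left h1 ha, mul_le_mul_of_nonneg_left h2 hb]

theorem isClosed_carrier {n : ℕ} (P : HPolytope n) : IsClosed P.carrier := by
  have : P.carrier = ⋂ h ∈ P, {x | h.form x ≤ h.bound} := by
    ext x
    simp only [Set.mem_iInter]
    rfl
  rw [this]
  exact isClosed_biInter fun h _ =>
    isClosed_le (LinearMap.continuous_of_finiteDimensional _) continuous_const

/-- A point at which all nontrivial inequalities are strict is an interior point. -/
theorem mem_interior_of_forall_lt {n : ℕ} {P : HPolytope n} {x : EuclideanSpace ℝ (Fin n)}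
    (hx : x ∈ P.carrier) (hlt : ∀ h ∈ P, h.normal ≠ 0 → h.form x < h.bound) :
    x ∈ interior P.carrier := by
  rw [mem_interior_iff_mem_nhds]
  have : ∀ᶠ y in nhds x, ∀ h ∈ {h | h ∈ P}, h.form y ≤ h.bound := by
    rw [Filter.eventually_all_finite (List.finite_toSet P)]
    intro h hh
    by_cases hn : h.normal = 0
    · refine Filter.Eventually.of_forall fun y => ?_
      have := hx h hh
      rw [HalfSpace.form_apply]
      rw [hn, zero_dotProduct] at this ⊢
      exact this
    · exact ((LinearMap.continuous_of_finiteDimensional h.form).continuousAt.eventually_lt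
        continuousAt_const (hlt h hh hn)).mono fun y hy => hy.le
  exact this

/-- A convex subset that meets every open half-space of the system has a point at which all
nontrivial inequalities are strict. -/
theorem exists_forall_lt {n : ℕ} : (P : HPolytope n) → {B : Set (EuclideanSpace ℝ (Fin n))} →
    Convex ℝ B → B.Nonempty → B ⊆ P.carrier →
    (∀ h ∈ P, h.normal ≠ 0 → ∃ b ∈ B, h.form b < h.bound) →
    ∃ b ∈ B, ∀ h ∈ P, h.normal ≠ 0 → h.form b < h.bound
  | [], _, _, hne, _, _ => hne.imp fun _ hb => ⟨hb, fun h hh => by simp at hh⟩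
  | h :: P, B, hB, hne, hsub, hex => by
      obtain ⟨b, hb, hlt⟩ := exists_forall_lt P hB hne
        (fun x hx g hg => hsub hx g (List.mem_cons_of_mem _ hg))
        fun g hg => hex g (List.mem_cons_of_mem _ hg)
      by_cases hn : h.normal = 0
      · refine ⟨b, hb, fun g hg hgn => ?_⟩
        rcases List.mem_cons.1 hg with rfl | hg
        · exact absurd hn hgn
        · exact hlt g hg hgn
      · obtain ⟨c, hc, hclt⟩ := hex h List.mem_cons_self hn
        refine ⟨(1 / 2 : ℝ) • b + (1 / 2 : ℝ) • c,
          hB hb hc (by norm_num) (by norm_num) (by norm_num), fun g hg hgn => ?_⟩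
        rw [map_add, map_smul, map_smul, smul_eq_mul, smul_eq_mul]
        have h1 : g.form b ≤ g.bound := hsub hb g hg
        have h2 : g.form c ≤ g.bound := hsub hc g hg
        rcases List.mem_cons.1 hg with rfl | hg
        · linarith
        · linarith [hlt g hg hgn]

theorem vectorSpan_le_ker {n : ℕ} {h : HalfSpace n} {B : Set (EuclideanSpace ℝ (Fin n))} {β : ℝ}
    (hB : ∀ b ∈ B, h.form b = β) : vectorSpan ℝ B ≤ LinearMap.ker h.form := by
  rw [vectorSpan_def, Submodule.span_le]
  rintro _ ⟨x, hx, y, hy, rfl⟩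
  simp [hB x hx, hB y hy]

theorem finrank_ker_form {n : ℕ} {h : HalfSpace n} (hn : h.normal ≠ 0) :
    Module.finrank ℝ (LinearMap.ker h.form) + 1 = n := by
  have h1 := Module.Dual.finrank_ker_add_one_of_ne_zero (HalfSpace.form_ne_zero hn)
  rwa [finrank_euclideanSpace_fin] at h1

/-- An `(n-1)`-dimensional convex face of a polyhedron is one of its facets. -/
theorem exists_facet_of_isExtreme {n : ℕ} {P : HPolytope n} {B : Set (EuclideanSpace ℝ (Fin n))}
    (hB : Convex ℝ B) (hne : B.Nonempty) (hext : IsExtreme ℝ P.carrier B)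
    (hdim : Module.finrank ℝ (vectorSpan ℝ B) + 1 = n) :
    ∃ F ∈ P.facets, F.carrier = B := by
  -- Were no nontrivial row tight on all of `B`, some point of `B` would be interior to the
  -- polyhedron; the face `B` would then be everything, of dimension `n`.
  have hrow : ∃ h ∈ P, h.normal ≠ 0 ∧ ∀ b ∈ B, h.form b = h.bound := by
    by_contra! hcon
    obtain ⟨b, hb, hlt⟩ := P.exists_forall_lt hB hne hext.subset fun h hh hn =>
      (hcon h hh hn).imp fun b hb => ⟨hb.1, lt_of_le_of_ne (hext.subset hb.1 h hh) hb.2⟩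
    have hint := mem_interior_of_forall_lt (hext.subset hb) hlt
    have hsub := hext.subset_of_mem_interior hint hb
    have htop : affineSpan ℝ B = ⊤ :=
      hB.interior_nonempty_iff_affineSpan_eq_top.1 ⟨b, interior_mono hsub hint⟩
    rw [← direction_affineSpan, htop, AffineSubspace.direction_top, finrank_top,
      finrank_euclideanSpace_fin] at hdim
    omega
  obtain ⟨h, hh, hn, htight⟩ := hrow
  have hspan : vectorSpan ℝ B = LinearMap.ker h.form := by
    refine Submodule.eq_of_le_of_finrank_eq (vectorSpan_le_ker htight) ?_
    have := finrank_ker_form hn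
    omega
  have heq : {x | x ∈ P.carrier ∧ h.normal ⬝ᵥ (fun j => x j) = h.bound} = B := by
    refine Set.Subset.antisymm ?_ fun b hb => ⟨hext.subset hb, htight b hb⟩
    rintro t ⟨htP, ht⟩
    -- From `t` move through a relative interior point `b` of `B` and a little further. The
    -- direction lies in the span of `B`, so the end is still in `B`, and extremality at `b` forces
    -- `t` into `B`.
    obtain ⟨b, hb⟩ := Set.Nonempty.intrinsicInterior hB hne
    have hbB : b ∈ B := intrinsicInterior_subset hb
    have hdir : b - t ∈ (affineSpan ℝ B).direction := by
      rw [direction_affineSpan, hspan, LinearMap.mem_ker, map_sub, htight b hbB,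
        HalfSpace.form_apply, ht, sub_self]
    obtain ⟨⟨b', hb'⟩, hint, hbb⟩ := hb
    obtain rfl : b' = b := hbb
    let γ : ℝ → affineSpan ℝ B := fun r =>
      ⟨r • (b' - t) +ᵥ b', AffineSubspace.vadd_mem_of_mem_direction
        (Submodule.smul_mem _ r hdir) hb'⟩
    have hγ : Continuous γ := by
      refine Continuous.subtype_mk ?_ _
      simp only [vadd_eq_add]
      fun_prop
    have hγ0 : γ 0 = ⟨b', hb'⟩ := by
      apply Subtype.ext
      simp [γ]
    have hnhds := hγ.continuousAt.preimage_mem_nhds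
      (show ((↑) ⁻¹' B : Set (affineSpan ℝ B)) ∈ nhds (γ 0) by
        rw [hγ0]; exact mem_interior_iff_mem_nhds.1 hint)
    obtain ⟨δ, hδ, hball⟩ := Metric.mem_nhds_iff.1 hnhds
    have hmem : (δ / 2) • (b' - t) +ᵥ b' ∈ B :=
      hball (by simp [abs_of_pos hδ, hδ] : δ / 2 ∈ Metric.ball (0 : ℝ) δ)
    refine hext.left_mem_of_mem_openSegment htP (hext.subset hmem) hbB
      ⟨(δ / 2) / (1 + δ / 2), 1 / (1 + δ / 2), by positivity, by positivity, by field_simp; ring, ?_⟩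
    have h1 : (1 + δ / 2) ≠ 0 := by positivity
    rw [vadd_eq_add]
    match_scalars <;> field_simp
    all_goals ring
  exact ⟨⟨h, B⟩, ⟨hh, hn, heq.symm, hne, hdim⟩, rfl⟩

theorem isExtreme_of_mem_facets {n : ℕ} {P : HPolytope n} {F : Facet n} (hF : F ∈ P.facets) :
    IsExtreme ℝ P.carrier F.carrier := by
  obtain ⟨hrow, -, hc, -, -⟩ := hF
  rw [hc]
  refine ⟨fun x hx => hx.1, ?_⟩
  rintro x hx y hy z ⟨-, hz⟩ ⟨a, b, ha, hb, hab, rfl⟩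
  refine ⟨hx, ?_⟩
  have h1 := hx _ hrow
  have h2 := hy _ hrow
  rw [← HalfSpace.form_apply] at *
  rw [map_add, map_smul, map_smul, smul_eq_mul, smul_eq_mul] at hz
  obtain rfl : b = 1 - a := by linarith
  nlinarith [mul_le_mul_of_nonneg_left h2 hb.le]

theorem convex_of_mem_facets {n : ℕ} {P : HPolytope n} {F : Facet n} (hF : F ∈ P.facets) :
    Convex ℝ F.carrier := by
  obtain ⟨-, -, hc, -, -⟩ := hF
  rw [hc]
  refine P.convex_carrier.inter fun x hx y hy a b ha hb hab => ?_
  replace hx : F.row.form x = F.row.bound := hx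
  replace hy : F.row.form y = F.row.bound := hy
  change F.row.form _ = _
  rw [map_add, map_smul, map_smul, hx, hy, ← add_smul, hab, one_smul]

theorem isClosed_of_mem_facets {n : ℕ} {P : HPolytope n} {F : Facet n} (hF : F ∈ P.facets) :
    IsClosed F.carrier := by
  obtain ⟨-, -, hc, -, -⟩ := hF
  rw [hc]
  exact P.isClosed_carrier.inter
    (isClosed_eq (LinearMap.continuous_of_finiteDimensional F.row.form) continuous_const)

/-- The facets of a polyhedron, as sets, do not depend on the system of inequalities. -/
theorem exists_facet_of_carrier_eq {n : ℕ} {P Q : HPolytope n} (h : P.carrier = Q.carrier)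
    {F : Facet n} (hF : F ∈ P.facets) : ∃ G ∈ Q.facets, G.carrier = F.carrier :=
  exists_facet_of_isExtreme (convex_of_mem_facets hF) hF.2.2.2.1
    (h ▸ isExtreme_of_mem_facets hF) hF.2.2.2.2

theorem finite_facets {n : ℕ} (P : HPolytope n) : P.facets.Finite := by
  refine ((List.finite_toSet P).image fun h => (⟨h, {x | x ∈ P.carrier ∧
    h.normal ⬝ᵥ (fun j => x j) = h.bound}⟩ : Facet n)).subset ?_
  rintro ⟨h, C⟩ ⟨hh, -, hc, -⟩
  refine ⟨h, hh, ?_⟩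
  simp only at hc
  rw [hc]

end HPolytope

/-! ### Generic segments -/

/-- Between two nonempty open sets there is a segment that avoids finitely many given affine
subspaces of codimension at least two. -/
theorem exists_segment_disjoint {n : ℕ} {ι : Type*} {I : Set ι} (hI : I.Finite)
    (A : ι → AffineSubspace ℝ (EuclideanSpace ℝ (Fin n)))
    (hA : ∀ i ∈ I, Module.finrank ℝ (A i).direction + 2 ≤ n)
    {U V : Set (EuclideanSpace ℝ (Fin n))} (hU : IsOpen U) (hUne : U.Nonempty) (hV : IsOpen V)
    (hVne : V.Nonempty) :
    ∃ a ∈ U, ∃ b ∈ V, ∀ i ∈ I, ∀ q ∈ segment ℝ a b, q ∉ A i := by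
  -- Finitely many proper affine subspaces have measure zero and cannot cover a nonempty open set.
  open MeasureTheory in
  have avoid : ∀ (B : ι → AffineSubspace ℝ (EuclideanSpace ℝ (Fin n))),
      (∀ i ∈ I, Module.finrank ℝ (B i).direction + 1 ≤ n) →
      ∀ W : Set (EuclideanSpace ℝ (Fin n)), IsOpen W → W.Nonempty → ∃ a ∈ W, ∀ i ∈ I, a ∉ B i := by
    intro B hB W hW hWne
    by_contra! hcon
    have h0 : (volume : Measure (EuclideanSpace ℝ (Fin n)))
        (⋃ i ∈ I, (B i : Set (EuclideanSpace ℝ (Fin n)))) = 0 := by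
      rw [measure_biUnion_null_iff hI.countable]
      intro i hi
      refine Measure.addHaar_affineSubspace _ _ fun htop => ?_
      have := hB i hi
      rw [htop, AffineSubspace.direction_top, finrank_top, finrank_euclideanSpace_fin] at this
      omega
    refine (hW.measure_pos volume hWne).ne' (measure_mono_null (fun a ha => ?_) h0)
    obtain ⟨i, hi, hai⟩ := hcon a ha
    exact Set.mem_biUnion hi hai
  obtain ⟨a, ha, haA⟩ := avoid A (fun i hi => by have := hA i hi; omega) U hU hUne
  -- Joining `a` to each subspace raises the dimension by at most one, so `b` can avoid these joins.
  -- A segment point in `A i` would put `b` on a line through `a` and `A i`, inside the join.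
  obtain ⟨b, hb, hbA⟩ := avoid (fun i => affineSpan ℝ (insert a (A i : Set _)))
    (fun i hi => by
      have h1 := finrank_vectorSpan_insert_le (A i) a
      have h2 := hA i hi
      rw [direction_affineSpan]
      omega) V hV hVne
  refine ⟨a, ha, b, hb, fun i hi q hq hqA => hbA i hi ?_⟩
  rw [segment_eq_image_lineMap] at hq
  obtain ⟨t, -, rfl⟩ := hq
  have ht : t ≠ 0 := by
    rintro rfl
    rw [AffineMap.lineMap_apply_zero] at hqA
    exact haA i hi hqA
  have hb' : b = AffineMap.lineMap a (AffineMap.lineMap a b t) t⁻¹ := by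
    simp only [AffineMap.lineMap_apply, vsub_eq_sub, vadd_eq_add, add_sub_cancel_right, smul_smul,
      inv_mul_cancel₀ ht, one_smul, sub_add_cancel]
  rw [hb']
  exact AffineMap.lineMap_mem _ (subset_affineSpan ℝ _ (Set.mem_insert _ _))
    (subset_affineSpan ℝ _ (Set.mem_insert_of_mem _ hqA))

/-! ### Polyhedral complexes -/

/-- A finite family of full-dimensional polyhedra that cover the space and meet face to face. -/
structure IsComplex {m : ℕ} (ℙ : Set (HPolytope m)) : Prop where
  finite : ℙ.Finite
  interior_nonempty : ∀ P ∈ ℙ, (interior (HPolytope.carrier P)).Nonempty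
  cover : ∀ z, ∃ P ∈ ℙ, z ∈ HPolytope.carrier P
  isExtreme : ∀ P ∈ ℙ, ∀ Q ∈ ℙ,
    IsExtreme ℝ (HPolytope.carrier P) (HPolytope.carrier P ∩ HPolytope.carrier Q)

namespace IsComplex

variable {m : ℕ} {ℙ : Set (HPolytope m)}

/-- Near `z` only the polyhedra containing `z` occur. -/
theorem eventually_mem (hℙ : IsComplex ℙ) (z : EuclideanSpace ℝ (Fin m)) :
    ∀ᶠ w in nhds z, ∀ P ∈ ℙ, w ∈ HPolytope.carrier P → z ∈ HPolytope.carrier P := by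
  rw [Filter.eventually_all_finite hℙ.finite]
  intro P _
  by_cases hz : z ∈ HPolytope.carrier P
  · exact Filter.Eventually.of_forall fun _ _ => hz
  · exact Filter.mem_of_superset ((HPolytope.isClosed_carrier P).isOpen_compl.mem_nhds hz)
      fun w hw hw' => absurd hw' hw

theorem isClosed_biUnion (hℙ : IsComplex ℙ) {𝕌 : Set (HPolytope m)} (h : 𝕌 ⊆ ℙ) :
    IsClosed (⋃ P ∈ 𝕌, HPolytope.carrier P) :=
  (hℙ.finite.subset h).isClosed_biUnion fun P _ => HPolytope.isClosed_carrier P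

theorem subset_closure_interior (hℙ : IsComplex ℙ) {P : HPolytope m} (hP : P ∈ ℙ) :
    HPolytope.carrier P ⊆ closure (interior (HPolytope.carrier P)) := by
  rw [(HPolytope.convex_carrier P).closure_interior_eq_closure_of_nonempty_interior
    (hℙ.interior_nonempty P hP)]
  exact subset_closure

/-- Different patterns or tied labels may present the same set by different systems, so overlapping
polyhedra are only equal as sets. -/
theorem carrier_eq_of_inter_interior (hℙ : IsComplex ℙ) {P Q : HPolytope m} (hP : P ∈ ℙ)
    (hQ : Q ∈ ℙ)
    (h : (interior (HPolytope.carrier P ∩ HPolytope.carrier Q)).Nonempty) :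
    HPolytope.carrier P = HPolytope.carrier Q := by
  obtain ⟨x, hx⟩ := h
  have hxm := interior_subset hx
  have h1 := (hℙ.isExtreme P hP Q hQ).subset_of_mem_interior
    (interior_mono Set.inter_subset_left hx) hxm
  have h2 := (hℙ.isExtreme Q hQ P hP).subset_of_mem_interior
    (interior_mono Set.inter_subset_right hx) ⟨hxm.2, hxm.1⟩
  exact Set.Subset.antisymm (fun a ha => (h1 ha).2) fun a ha => (h2 ha).2

/-- Two polyhedra of the complex whose intersection has codimension at most one coincide or share
a facet. -/
theorem eq_or_common_facet (hℙ : IsComplex ℙ) {P Q : HPolytope m} (hP : P ∈ ℙ) (hQ : Q ∈ ℙ)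
    (hne : (HPolytope.carrier P ∩ HPolytope.carrier Q).Nonempty)
    (hdim : m ≤ Module.finrank ℝ (vectorSpan ℝ (HPolytope.carrier P ∩ HPolytope.carrier Q)) + 1) :
    HPolytope.carrier P = HPolytope.carrier Q ∨
      ∃ F ∈ HPolytope.facets P, ∃ G ∈ HPolytope.facets Q, F.carrier = G.carrier ∧
        F.carrier = HPolytope.carrier P ∩ HPolytope.carrier Q := by
  have hconv := (HPolytope.convex_carrier P).inter (HPolytope.convex_carrier Q)
  rcases eq_or_lt_of_le hdim with heq | hlt
  · right
    obtain ⟨F, hF, hFc⟩ :=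
      HPolytope.exists_facet_of_isExtreme hconv hne (hℙ.isExtreme P hP Q hQ) heq.symm
    obtain ⟨G, hG, hGc⟩ :=
      HPolytope.exists_facet_of_isExtreme hconv hne
        (Set.inter_comm (HPolytope.carrier Q) _ ▸ hℙ.isExtreme Q hQ P hP) heq.symm
    exact ⟨F, hF, G, hG, hFc.trans hGc.symm, hFc⟩
  · left
    refine hℙ.carrier_eq_of_inter_interior hP hQ ?_
    rw [hconv.interior_nonempty_iff_affineSpan_eq_top,
      AffineSubspace.affineSpan_eq_top_iff_vectorSpan_eq_top_of_nonempty _ _ _ hne]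
    apply Submodule.eq_top_of_finrank_eq
    have := Submodule.finrank_le
      (vectorSpan ℝ (HPolytope.carrier P ∩ HPolytope.carrier Q))
    rw [finrank_euclideanSpace_fin] at this ⊢
    omega

/-- A family of polyhedra of the complex that is closed under passing through facets containing
the point `p` is all of the star of `p`, if it contains one polyhedron of the star. -/
theorem mem_of_mem_star (hℙ : IsComplex ℙ) {𝕌 : Set (HPolytope m)} {p : EuclideanSpace ℝ (Fin m)}
    (heq : ∀ P ∈ 𝕌, ∀ Q ∈ ℙ, HPolytope.carrier P = HPolytope.carrier Q → Q ∈ 𝕌)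
    (hfacet : ∀ P ∈ 𝕌, ∀ Q ∈ ℙ, ∀ F ∈ HPolytope.facets P, ∀ G ∈ HPolytope.facets Q,
      F.carrier = G.carrier → p ∈ F.carrier → Q ∈ 𝕌)
    {P Q : HPolytope m} (hP : P ∈ ℙ) (hQ : Q ∈ ℙ) (hPU : P ∈ 𝕌) (hpP : p ∈ HPolytope.carrier P)
    (hpQ : p ∈ HPolytope.carrier Q) : Q ∈ 𝕌 := by
  by_contra hQU
  obtain ⟨r, hr, hball⟩ := Metric.eventually_nhds_iff_ball.1 (hℙ.eventually_mem p)
  -- The pairs whose intersection is too small to be a facet; the segment chosen below misses all of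
  -- them.
  let I : Set (HPolytope m × HPolytope m) := {R | R.1 ∈ ℙ ∧ R.2 ∈ ℙ ∧
    Module.finrank ℝ (vectorSpan ℝ (HPolytope.carrier R.1 ∩ HPolytope.carrier R.2)) + 2 ≤ m}
  have hI : I.Finite := (hℙ.finite.prod hℙ.finite).subset fun R hR => ⟨hR.1, hR.2.1⟩
  have hopen : ∀ R ∈ ℙ, p ∈ HPolytope.carrier R →
      (Metric.ball p r ∩ interior (HPolytope.carrier R)).Nonempty := fun R hR hpR =>
    mem_closure_iff.1 (hℙ.subset_closure_interior hR hpR) _ Metric.isOpen_ball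
      (Metric.mem_ball_self hr)
  obtain ⟨a, ha, b, hb, hseg⟩ := exists_segment_disjoint hI
    (fun R => affineSpan ℝ (HPolytope.carrier R.1 ∩ HPolytope.carrier R.2))
    (fun R hR => by rw [direction_affineSpan]; exact hR.2.2)
    (Metric.isOpen_ball.inter isOpen_interior) (hopen P hP hpP)
    (Metric.isOpen_ball.inter isOpen_interior) (hopen Q hQ hpQ)
  have hsub : segment ℝ a b ⊆ Metric.ball p r := (convex_ball p r).segment_subset ha.1 hb.1
  -- The polyhedra inside and outside `𝕌` give two closed sets covering the connected segment, so
  -- they meet at some `q`. As `q` is close to `p`, both polyhedra through `q` contain `p`.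
  obtain ⟨q, hq, hqU, hqV⟩ := isPreconnected_closed_iff.1 (convex_segment a b).isPreconnected
    _ _ (hℙ.isClosed_biUnion (𝕌 := 𝕌 ∩ ℙ) Set.inter_subset_right)
    (hℙ.isClosed_biUnion (𝕌 := ℙ \ 𝕌) Set.sdiff_subset)
    (fun q _ => by
      obtain ⟨R, hR, hqR⟩ := hℙ.cover q
      by_cases hRU : R ∈ 𝕌
      · exact Or.inl (Set.mem_biUnion ⟨hRU, hR⟩ hqR)
      · exact Or.inr (Set.mem_biUnion ⟨hR, hRU⟩ hqR))
    ⟨a, left_mem_segment ℝ a b, Set.mem_biUnion ⟨hPU, hP⟩ (interior_subset ha.2)⟩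
    ⟨b, right_mem_segment ℝ a b, Set.mem_biUnion ⟨hQ, hQU⟩ (interior_subset hb.2)⟩
  simp only [Set.mem_iUnion, exists_prop] at hqU hqV
  obtain ⟨R, ⟨hRU, hR⟩, hqR⟩ := hqU
  obtain ⟨T, ⟨hT, hTU⟩, hqT⟩ := hqV
  have hpR := hball q (hsub hq) R hR hqR
  have hpT := hball q (hsub hq) T hT hqT
  have hdim : m ≤
      Module.finrank ℝ (vectorSpan ℝ (HPolytope.carrier R ∩ HPolytope.carrier T)) + 1 := by
    by_contra! hlt
    exact hseg (R, T) ⟨hR, hT, hlt⟩ q hq (subset_affineSpan ℝ _ ⟨hqR, hqT⟩)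
  rcases hℙ.eq_or_common_facet hR hT ⟨q, hqR, hqT⟩ hdim with h | ⟨F, hF, G, hG, hFG, hFc⟩
  · exact hTU (heq R hRU T hT h)
  · exact hTU (hfacet R hRU T hT F hF G hG hFG (hFc ▸ ⟨hpR, hpT⟩))

/-- A family of polyhedra of the complex that is closed under passing through facets that meet the
connected set `S` contains all polyhedra that meet `S`, if it contains one of them. -/
theorem mem_of_meets (hℙ : IsComplex ℙ) {𝕌 : Set (HPolytope m)}
    {S : Set (EuclideanSpace ℝ (Fin m))} (hS : IsPreconnected S)
    (heq : ∀ P ∈ 𝕌, ∀ Q ∈ ℙ, HPolytope.carrier P = HPolytope.carrier Q → Q ∈ 𝕌)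
    (hfacet : ∀ P ∈ 𝕌, ∀ Q ∈ ℙ, ∀ F ∈ HPolytope.facets P, ∀ G ∈ HPolytope.facets Q,
      F.carrier = G.carrier → (S ∩ F.carrier).Nonempty → Q ∈ 𝕌)
    {P Q : HPolytope m} (hP : P ∈ ℙ) (hQ : Q ∈ ℙ) (hPU : P ∈ 𝕌)
    (hSP : (S ∩ HPolytope.carrier P).Nonempty) (hSQ : (S ∩ HPolytope.carrier Q).Nonempty) :
    Q ∈ 𝕌 := by
  by_contra hQU
  obtain ⟨x, hxS, hxP⟩ := hSP
  obtain ⟨y, hyS, hyQ⟩ := hSQ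
  obtain ⟨q, hq, hqU, hqV⟩ := isPreconnected_closed_iff.1 hS
    _ _ (hℙ.isClosed_biUnion (𝕌 := 𝕌 ∩ ℙ) Set.inter_subset_right)
    (hℙ.isClosed_biUnion (𝕌 := ℙ \ 𝕌) Set.sdiff_subset)
    (fun q _ => by
      obtain ⟨R, hR, hqR⟩ := hℙ.cover q
      by_cases hRU : R ∈ 𝕌
      · exact Or.inl (Set.mem_biUnion ⟨hRU, hR⟩ hqR)
      · exact Or.inr (Set.mem_biUnion ⟨hR, hRU⟩ hqR))
    ⟨x, hxS, Set.mem_biUnion ⟨hPU, hP⟩ hxP⟩ ⟨y, hyS, Set.mem_biUnion ⟨hQ, hQU⟩ hyQ⟩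
  simp only [Set.mem_iUnion, exists_prop] at hqU hqV
  obtain ⟨R, ⟨hRU, hR⟩, hqR⟩ := hqU
  obtain ⟨T, ⟨hT, hTU⟩, hqT⟩ := hqV
  exact hTU (hℙ.mem_of_mem_star heq
    (fun P hP Q hQ F hF G hG hFG hqF => hfacet P hP Q hQ F hF G hG hFG ⟨q, hq, hqF⟩)
    hR hT hRU hqR hqT)

end IsComplex

/-- The full-dimensional slices of the polytopes of a network form a complex. -/
theorem isComplex_reducePolyDim {k m K : ℕ} (N : ReLUNet (k + m) K) (hK : 0 < K)
    (s : Fin k → ℝ) : IsComplex (reducePolyDim N.polytopes s) where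
  finite := by
    refine (N.finite_polytopes.image fun P => HPolytope.reduce P s).subset ?_
    rintro _ ⟨⟨P, hP, rfl⟩, -⟩
    exact ⟨P, hP, rfl⟩
  interior_nonempty P hP := hP.2
  cover := by
    have := N.finite_pattern
    let T : N.Pattern × Fin K → Set (EuclideanSpace ℝ (Fin m)) := fun q =>
      HPolytope.carrier (N.slicedPolytope s q.1 q.2)
    have hclosed : ∀ q, IsClosed (T q) := fun q => HPolytope.isClosed_carrier _
    -- Finitely many closed slices cover the space, so their interiors are dense; closure commutes
    -- with the finite union, and slices without interior can be dropped.
    have hdense := dense_iUnion_interior_of_closed hclosed (by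
      refine Set.eq_univ_of_forall fun z => ?_
      obtain ⟨σ, y, h⟩ := N.exists_mem_slicedPolytope hK s z
      exact Set.mem_iUnion.2 ⟨(σ, y), h⟩)
    intro z
    have hz := hdense z
    rw [closure_iUnion_of_finite] at hz
    obtain ⟨q, hq⟩ := Set.mem_iUnion.1 hz
    refine ⟨N.slicedPolytope s q.1 q.2, ⟨⟨_, ⟨q.1, q.2, rfl⟩, rfl⟩, ?_⟩,
      (hclosed q).closure_interior_subset hq⟩
    exact closure_nonempty_iff.1 ⟨z, hq⟩
  isExtreme := by
    rintro _ ⟨⟨_, ⟨σ, y, rfl⟩, rfl⟩, -⟩ _ ⟨⟨_, ⟨σ', y', rfl⟩, rfl⟩, -⟩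
    exact N.isExtreme_slicedPolytope s σ σ' y y'

/-! ### Runs of GeoCert -/

section Runs

variable {m : ℕ} {Y : Type*} {ℙ : Set (HPolytope m)} {g : EuclideanSpace ℝ (Fin m) → Y}
  {dst : EuclideanSpace ℝ (Fin m) → Facet m → ℝ} {x : EuclideanSpace ℝ (Fin m)} {ε : ℝ≥0∞}

/-- At the end of a run, the seen polytopes are closed under passing through facets that are
nearer than the returned value, and none of these facets is a boundary facet. -/
theorem GeoCert.Loop.exists_seen {Q : Set (Facet m)} {C : Set (HPolytope m)}
    (h : Loop ℙ g dst x Q C ε) (hC : C ⊆ ℙ)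
    (hinv : ∀ P ∈ C, ∀ F ∈ HPolytope.facets P, F ∈ Q ∨ ¬ IsBoundary g F ∧ neighbors ℙ F ⊆ C) :
    ∃ C', C ⊆ C' ∧ C' ⊆ ℙ ∧ ∀ P ∈ C', ∀ F ∈ HPolytope.facets P, ENNReal.ofReal (dst x F) < ε →
      ¬ IsBoundary g F ∧ neighbors ℙ F ⊆ C' := by
  induction h with
  | empty C =>
    exact ⟨C, subset_rfl, hC, fun P hP F hF _ => (hinv P hP F hF).resolve_left (Set.notMem_empty F)⟩
  | boundary Q C F hF hmin hb =>
    exact ⟨C, subset_rfl, hC, fun P hP G hG hlt => (hinv P hP G hG).resolve_left fun hGQ =>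
      hlt.not_ge (ENNReal.ofReal_le_ofReal (hmin G hGQ))⟩
  | step Q C F hF hmin hb ε hnext ih =>
    obtain ⟨C', hCC', hC', h⟩ := ih (Set.union_subset hC fun P hP => hP.1) (by
      intro P hP G hG
      -- An old polytope loses at most the popped facet from the queue, and the neighbors of that
      -- facet are now seen; a new polytope has all its facets queued.
      by_cases hPC : P ∈ C
      · rcases hinv P hPC G hG with hGQ | ⟨hGb, hGn⟩
        · by_cases hGF : G = F
          · subst hGF
            exact Or.inr ⟨hb, Set.subset_union_right⟩
          · exact Or.inl (Or.inl ⟨hGQ, hGF⟩)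
        · exact Or.inr ⟨hGb, hGn.trans Set.subset_union_left⟩
      · exact Or.inl (Or.inr ⟨P, ⟨hP.resolve_left hPC, hPC⟩, hG⟩))
    exact ⟨C', Set.subset_union_left.trans hCC', hC', h⟩

theorem GeoCert.exists_seen (h : GeoCert ℙ g dst x ε) :
    ∃ C ⊆ ℙ, (∃ P ∈ C, x ∈ HPolytope.carrier P) ∧
      ∀ P ∈ C, ∀ F ∈ HPolytope.facets P, ENNReal.ofReal (dst x F) < ε →
        ¬ IsBoundary g F ∧ neighbors ℙ F ⊆ C := by
  obtain ⟨P, hP, hx, hloop⟩ := h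
  obtain ⟨C, hPC, hC, h⟩ := hloop.exists_seen (Set.singleton_subset_iff.2 hP)
    fun R hR F hF => Or.inl (by rw [Set.mem_singleton_iff.1 hR] at hF; exact hF)
  exact ⟨C, hC, ⟨P, hPC rfl, hx⟩, h⟩

/-- A finite output is the distance of a boundary facet of the complex. -/
theorem GeoCert.Loop.eq_top_or_exists_facet {Q : Set (Facet m)} {C : Set (HPolytope m)}
    (h : Loop ℙ g dst x Q C ε) (hQ : ∀ F ∈ Q, ∃ P ∈ ℙ, F ∈ HPolytope.facets P) :
    ε = ⊤ ∨ ∃ P ∈ ℙ, ∃ F ∈ HPolytope.facets P, IsBoundary g F ∧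
      ε = ENNReal.ofReal (dst x F) := by
  induction h with
  | empty C => exact Or.inl rfl
  | boundary Q C F hF hmin hb =>
    obtain ⟨P, hP, hFP⟩ := hQ F hF
    exact Or.inr ⟨P, hP, F, hFP, hb, rfl⟩
  | step Q C F hF hmin hb ε hnext ih =>
    refine ih ?_
    rintro G (hG | ⟨P, hP, hG⟩)
    · exact hQ G hG.1
    · exact ⟨P, hP.1.1, hG⟩

theorem GeoCert.eq_top_or_exists_facet (h : GeoCert ℙ g dst x ε) :
    ε = ⊤ ∨ ∃ P ∈ ℙ, ∃ F ∈ HPolytope.facets P, IsBoundary g F ∧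
      ε = ENNReal.ofReal (dst x F) := by
  obtain ⟨P, hP, -, hloop⟩ := h
  exact hloop.eq_top_or_exists_facet fun F hF => ⟨P, hP, hF⟩

/-- The loop terminates: every step sees a new polytope or shortens the queue. -/
theorem GeoCert.Loop.exists_output (hℙ : ℙ.Finite) (g : EuclideanSpace ℝ (Fin m) → Y)
    (dst : EuclideanSpace ℝ (Fin m) → Facet m → ℝ) (x : EuclideanSpace ℝ (Fin m))
    (Q : Set (Facet m)) (hQ : Q.Finite) (C : Set (HPolytope m)) :
    ∃ ε, Loop ℙ g dst x Q C ε := by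
  rcases Q.eq_empty_or_nonempty with rfl | hne
  · exact ⟨⊤, .empty C⟩
  obtain ⟨F, hF, hmin⟩ := hQ.exists_minimalFor (dst x) Q hne
  replace hmin : ∀ G ∈ Q, dst x F ≤ dst x G := fun G hG =>
    (le_total (dst x F) (dst x G)).elim id fun h => hmin hG h
  by_cases hb : IsBoundary g F
  · exact ⟨_, .boundary Q C F hF hmin hb⟩
  have hfin : ((Q \ {F}) ∪ {G | ∃ P ∈ neighbors ℙ F \ C, G ∈ HPolytope.facets P}).Finite := by
    refine (hQ.sdiff).union ((hℙ.biUnion fun P _ => HPolytope.finite_facets P).subset ?_)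
    rintro G ⟨P, hP, hG⟩
    exact Set.mem_biUnion hP.1.1 hG
  obtain ⟨ε, hε⟩ := exists_output hℙ g dst x _ hfin (C ∪ neighbors ℙ F)
  exact ⟨ε, .step Q C F hF hmin hb ε hε⟩
termination_by ((ℙ \ C).ncard, Q.ncard)
decreasing_by
  rcases (neighbors ℙ F \ C).eq_empty_or_nonempty with h | ⟨P, hP⟩
  · have h1 : C ∪ neighbors ℙ F = C := Set.union_eq_left.2 (Set.sdiff_eq_empty.1 h)
    have h2 : {G | ∃ P ∈ neighbors ℙ F \ C, G ∈ HPolytope.facets P} = ∅ := by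
      rw [h]
      ext G
      simp
    rw [h1, h2, Set.union_empty]
    exact Prod.Lex.right _ (Set.ncard_sdiff_singleton_lt_of_mem hF hQ)
  · refine Prod.Lex.left _ _ (Set.ncard_lt_ncard ?_ hℙ.sdiff)
    refine ⟨Set.sdiff_subset_sdiff_right Set.subset_union_left, fun hsub => ?_⟩
    exact (hsub ⟨hP.1.1, hP.2⟩).2 (Or.inr hP.1)

theorem IsComplex.exists_geoCert (hℙ : IsComplex ℙ) (g : EuclideanSpace ℝ (Fin m) → Y)
    (dst : EuclideanSpace ℝ (Fin m) → Facet m → ℝ) (x : EuclideanSpace ℝ (Fin m)) :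
    ∃ ε, GeoCert ℙ g dst x ε := by
  obtain ⟨P, hP, hx⟩ := hℙ.cover x
  obtain ⟨ε, hε⟩ := GeoCert.Loop.exists_output hℙ.finite g dst x _ P.finite_facets {P}
  exact ⟨ε, P, hP, hx, hε⟩

/-! ### The projection distance as a lower bound -/

/-- Cauchy–Schwarz for the normal vector and `y - x`. -/
theorem distProj_le_dist {F : Facet m} (hn : F.row.normal ≠ 0) {y : EuclideanSpace ℝ (Fin m)}
    (hy : F.row.normal ⬝ᵥ (fun j => y j) = F.row.bound) : distProj x F ≤ dist x y := by
  have hpos : 0 < ‖WithLp.toLp 2 F.row.normal‖ :=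
    norm_pos_iff.2 fun h => hn (by simpa using congrArg WithLp.ofLp h)
  rw [distProj, div_le_iff₀ hpos, ← hy, dist_comm, dist_eq_norm, mul_comm]
  have h1 : F.row.normal ⬝ᵥ (fun j => y j) - F.row.normal ⬝ᵥ (fun j => x j) =
      inner ℝ (WithLp.toLp 2 F.row.normal) (y - x) := by
    rw [← dotProduct_sub, EuclideanSpace.inner_eq_star_dotProduct, dotProduct_comm]
    rfl
  rw [h1]
  exact abs_real_inner_le_norm _ _

theorem distProj_le_of_meets {P : HPolytope m} {F : Facet m} (hF : F ∈ HPolytope.facets P) {r : ℝ}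
    (h : (Metric.closedBall x r ∩ F.carrier).Nonempty) : distProj x F ≤ r := by
  obtain ⟨y, hy, hyF⟩ := h
  obtain ⟨-, hn, hc, -, -⟩ := hF
  rw [hc] at hyF
  exact (distProj_le_dist hn hyF.2).trans (dist_comm x y ▸ hy)

/-- No boundary facet of the complex meets a ball whose radius is smaller than the output for the
projection distance. -/
theorem IsComplex.not_isBoundary (hℙ : IsComplex ℙ) (h : GeoCert ℙ g distProj x ε) {r : ℝ}
    (hr : 0 ≤ r) (hrε : ENNReal.ofReal r < ε) {Q : HPolytope m} (hQ : Q ∈ ℙ) {G : Facet m}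
    (hG : G ∈ HPolytope.facets Q) (hmeet : (Metric.closedBall x r ∩ G.carrier).Nonempty) :
    ¬ IsBoundary g G := by
  obtain ⟨C, hC, ⟨P, hPC, hxP⟩, hclosed⟩ := h.exists_seen
  have hnear : ∀ R ∈ C, ∀ F ∈ HPolytope.facets R, (Metric.closedBall x r ∩ F.carrier).Nonempty →
      ¬ IsBoundary g F ∧ neighbors ℙ F ⊆ C := fun R hR F hF hF' =>
    hclosed R hR F hF ((ENNReal.ofReal_le_ofReal (distProj_le_of_meets hF hF')).trans_lt hrε)
  -- The seen set is enlarged by all systems with the same carrier. Adjacency compares facets as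
  -- sets, so a step from such a copy is also a step from the seen polytope.
  have hQU : Q ∈ {R | ∃ T ∈ C, HPolytope.carrier T = HPolytope.carrier R} := by
    refine hℙ.mem_of_meets (convex_closedBall x r).isPreconnected ?_ ?_ (hC hPC) hQ ⟨P, hPC, rfl⟩
      ⟨x, Metric.mem_closedBall_self hr, hxP⟩
      (hmeet.mono (Set.inter_subset_inter_right _ (HPolytope.isExtreme_of_mem_facets hG).subset))
    · rintro R ⟨T, hT, hTR⟩ R' - hRR'
      exact ⟨T, hT, hTR.trans hRR'⟩
    · rintro R ⟨T, hT, hTR⟩ R' hR' F hF F' hF' hFF' hF''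
      obtain ⟨E, hE, hEF⟩ := HPolytope.exists_facet_of_carrier_eq hTR.symm hF
      exact ⟨R', (hnear T hT E hE (hEF ▸ hF'')).2 ⟨hR', F', hF', hFF'.symm.trans hEF.symm⟩, rfl⟩
  obtain ⟨T, hT, hTQ⟩ := hQU
  obtain ⟨E, hE, hEG⟩ := HPolytope.exists_facet_of_carrier_eq hTQ.symm hG
  intro hb
  refine (hnear T hT E hE (hEG ▸ hmeet)).1 ?_
  rw [IsBoundary, hEG]
  exact hb

/-- The nearest point of a closed boundary facet lies in the closed ball whose radius is its exact
distance, so that radius cannot be below the projection output. -/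
theorem IsComplex.geoCert_distProj_le_distL2 (hℙ : IsComplex ℙ) {ε' : ℝ≥0∞}
    (h : GeoCert ℙ g distProj x ε) (h' : GeoCert ℙ g distL2 x ε') : ε ≤ ε' := by
  rcases h'.eq_top_or_exists_facet with rfl | ⟨P, hP, F, hF, hb, rfl⟩
  · exact le_top
  · by_contra! hlt
    obtain ⟨y, hy, hxy⟩ := (HPolytope.isClosed_of_mem_facets hF).exists_infDist_eq_dist
      hF.2.2.2.1 x
    exact hℙ.not_isBoundary h Metric.infDist_nonneg hlt hP hF
      ⟨y, Metric.mem_closedBall'.2 hxy.symm.le, hy⟩ hb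

/-- If the classifier is constant on the interiors of the polytopes and its decision regions have no
lower-dimensional pieces, it is constant on every ball whose radius is smaller than the output. -/
theorem IsComplex.eq_of_mem_closedBall (hℙ : IsComplex ℙ)
    (hconst : ∀ P ∈ ℙ, ∀ u ∈ interior (HPolytope.carrier P), ∀ v ∈ interior (HPolytope.carrier P),
      g u = g v)
    (hfull : FullDimRegions g) (h : GeoCert ℙ g distProj x ε) {r : ℝ} (hr : 0 ≤ r)
    (hrε : ENNReal.ofReal r < ε) {z : EuclideanSpace ℝ (Fin m)} (hz : z ∈ Metric.closedBall x r) :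
    g z = g x := by
  -- Every point belongs to a polytope whose interior carries its own label: near `u` there is an
  -- open set with that label, and it meets the interior of a polytope through `u`.
  have hlabel : ∀ u, ∃ P ∈ ℙ, u ∈ HPolytope.carrier P ∧
      ∀ w ∈ interior (HPolytope.carrier P), g w = g u := by
    intro u
    obtain ⟨t, ht, htr⟩ := Metric.eventually_nhds_iff_ball.1 (hℙ.eventually_mem u)
    obtain ⟨v, hvb, hv⟩ := mem_closure_iff.1 (hfull u) _ Metric.isOpen_ball
      (Metric.mem_ball_self ht)
    obtain ⟨P, hP, hvP⟩ := hℙ.cover v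
    obtain ⟨w, hw, hwP⟩ := mem_closure_iff.1 (hℙ.subset_closure_interior hP hvP) _
      isOpen_interior hv
    have hwu : w ∈ {w | g w = g u} := interior_subset hw
    exact ⟨P, hP, htr v hvb P hP hvP, fun w' hw' => (hconst P hP w' hw' w hwP).trans hwu⟩
  obtain ⟨P, hP, hxP, hPg⟩ := hlabel x
  obtain ⟨Q, hQ, hzQ, hQg⟩ := hlabel z
  have hQU : Q ∈ {R | R ∈ ℙ ∧ ∀ w ∈ interior (HPolytope.carrier R), g w = g x} := by
    refine hℙ.mem_of_meets (convex_closedBall x r).isPreconnected ?_ ?_ hP hQ ⟨hP, hPg⟩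
      ⟨x, Metric.mem_closedBall_self hr, hxP⟩ ⟨z, hz, hzQ⟩
    · rintro R ⟨-, hRg⟩ T hT hRT
      exact ⟨hT, hRT ▸ hRg⟩
    · rintro R ⟨hR, hRg⟩ T hT F hF G hG hFG hmeet
      refine ⟨hT, fun w hw => ?_⟩
      by_contra hwx
      -- If the label changed from `R` to `T`, every point of the common facet would be a limit of
      -- both interiors, hence on the frontier of the region of `g x`.
      refine hℙ.not_isBoundary h hr hrε hR hF hmeet fun q hq => ⟨g x, ?_⟩
      rw [frontier_eq_closure_inter_closure]
      constructor
      · exact closure_mono (fun u hu => hRg u hu)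
          (hℙ.subset_closure_interior hR ((HPolytope.isExtreme_of_mem_facets hF).subset hq))
      · have hsub : interior (HPolytope.carrier T) ⊆ {w | g w = g x}ᶜ := fun u hu hux =>
          hwx ((hconst T hT w hw u hu).trans hux)
        exact closure_mono hsub (hℙ.subset_closure_interior hT
          ((HPolytope.isExtreme_of_mem_facets hG).subset (hFG ▸ hq)))
  obtain ⟨w, hw⟩ := hℙ.interior_nonempty Q hQ
  exact (hQg w hw).symm.trans (hQU.2 w hw)

end Runs

/-! ### From slices to individual fairness -/

theorem le_fairnessParameter {X Y : Type*} {f : X → Y} {d : X → X → ℝ} {D : Set X} {x : X}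
    {ε : ℝ≥0∞} (h : ∀ r : ℝ≥0, (r : ℝ≥0∞) < ε → IsIndividuallyFair f d D x r) :
    ε ≤ fairnessParameter f d D x :=
  ENNReal.le_of_forall_nnreal_lt fun r hr => le_iSup₂_of_le r (h r hr) le_rfl

end FairCert

theorem mainTheorem1 {k m K : ℕ} (N : FairCert.ReLUNet (k + m) K)
    (tie : Finset (Fin K) → Fin K) (htie : ∀ A : Finset (Fin K), A.Nonempty → tie A ∈ A)
    (dom : Fin k → Finset ℝ) (xs : Fin (k + m) → ℝ) :
    -- the algorithm has an output, with either distance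
    (∃ ε, FairCert.Certifies N tie dom FairCert.distProj xs ε) ∧
    (∃ ε, FairCert.Certifies N tie dom FairCert.distL2 xs ε) ∧
    -- every output for the projection distance is at most every output for the exact distance
    (∀ εproj εl2, FairCert.Certifies N tie dom FairCert.distProj xs εproj →
      FairCert.Certifies N tie dom FairCert.distL2 xs εl2 → εproj ≤ εl2) ∧
    ((∀ s ∈ Fintype.piFinset dom, FairCert.FullDimRegions (N.slice tie s)) →
      ∀ εLB, FairCert.Certifies N tie dom FairCert.distProj xs εLB →
        -- it is at most the smallest exact robustness radius of the slices
        (∀ s ∈ Fintype.piFinset dom,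
          εLB ≤ FairCert.robustnessRadius (N.slice tie s) (FairCert.nonSensitive xs)) ∧
        -- it is at most the exact local individual fairness parameter, if there is one
        ((∃ ε, FairCert.IsIndividuallyFair (N.classify tie) FairCert.fairDist
            (FairCert.admissible m dom) xs ε) →
          εLB ≤ FairCert.fairnessParameter (N.classify tie) FairCert.fairDist
            (FairCert.admissible m dom) xs)) := by
  -- The tie rule returns a label even on the empty set, so there is at least one label.
  have hK : 0 < K := (tie ∅).pos
  have hℙ := FairCert.isComplex_reducePolyDim N hK
  have hexists : ∀ dst, ∃ ε, FairCert.Certifies N tie dom dst xs ε := by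
    intro dst
    choose εs hεs using fun s =>
      (hℙ s).exists_geoCert (N.slice tie s) dst (FairCert.nonSensitive xs)
    exact ⟨_, εs, fun s _ => hεs s, rfl⟩
  refine ⟨hexists _, hexists _, ?_, ?_⟩
  · rintro _ _ ⟨εs, hεs, rfl⟩ ⟨εs', hεs', rfl⟩
    exact Finset.inf_mono_fun fun s hs =>
      (hℙ s).geoCert_distProj_le_distL2 (hεs s hs) (hεs' s hs)
  · rintro hfull _ ⟨εs, hεs, rfl⟩
    have hball : ∀ s ∈ Fintype.piFinset dom, ∀ r : ℝ≥0,
        (r : ℝ≥0∞) < (Fintype.piFinset dom).inf εs → ∀ z, dist z (FairCert.nonSensitive xs) ≤ r →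
        N.slice tie s z = N.slice tie s (FairCert.nonSensitive xs) := by
      intro s hs r hr z hz
      refine (hℙ s).eq_of_mem_closedBall ?_ (hfull s hs) (hεs s hs) r.coe_nonneg ?_ hz
      · rintro _ ⟨⟨_, ⟨σ, y, rfl⟩, rfl⟩, -⟩ u hu v hv
        exact N.slice_eq_of_mem_interior tie s hu hv
      · rw [ENNReal.ofReal_coe_nnreal]
        exact hr.trans_le (Finset.inf_le hs)
    refine ⟨fun s hs => ?_, ?_⟩
    · exact FairCert.le_fairnessParameter fun r hr z _ hz => (hball s hs r hr z hz).symm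
    · rintro ⟨ε, hε⟩
      refine FairCert.le_fairnessParameter fun r hr x hx hxr => ?_
      have hs : (fun i => x (Fin.castAdd m i)) ∈ Fintype.piFinset dom := Fintype.mem_piFinset.2 hx
      have hsplit : ∀ z : EuclideanSpace ℝ (Fin m), FairCert.nonSensitive
          (Fin.append (fun i => x (Fin.castAdd m i)) fun j => z j) = z := by
        intro z
        ext j
        simp [FairCert.nonSensitive]
      have hx' : N.classify tie x =
          N.slice tie (fun i => x (Fin.castAdd m i)) (FairCert.nonSensitive x) := by
        unfold FairCert.ReLUNet.slice
        congr 1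
        exact (Fin.append_castAdd_natAdd (f := x)).symm
      rw [hx', hball _ hs r hr _ hxr]
      -- The sensitive part of `xs` need not be admissible. Any existing fairness radius, applied at
      -- distance zero, identifies the label of `xs` with that of its copy having the sensitive
      -- values of `x`.
      refine hε _ (fun i => ?_) ?_
      · rw [Fin.append_left]
        exact hx i
      · rw [FairCert.fairDist, hsplit, dist_self]
        exact ε.coe_nonneg
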